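/- Let $G$ be a finite group of order $k$. For $n\ge 1$ put $N=n(k-1)$, and let $E_NG=G*\dots*G$ be the $(N+1)$-fold join of the $0$-dimensional simplicial complex $G$ with itself: its vertices are the pairs $(g,i)\in G\times[N+1]$, and a nonempty set of vertices is a simplex if it contains at most one vertex $(g,i)$ for each $i$. It is realized geometrically in $\mathbb R^{G\times[N+1]}$ with the standard basis vectors as vertices, and $G$ acts on it diagonally, by $h\cdot(g,i)=(hg,i)$. Let $W_G=\{x\in\mathbb R[G] : \sum_{g\in G}x_g=0\}$, a subrepresentation of the real regular representation $\mathbb R[G]$ with basis $(e_g)_{g\in G}$. The generalized crosspolytope $\Diamond_G^n\subset (W_G)^n$ is the convex hull of $\bigcup_{i=1}^n\Delta_{(i)}$, where $\Delta_{(i)}$ is the simplex in the $i$-th copy of $W_G$ spanned by the orthogonal projections $e_g-\frac1k\sum_{h\in G}e_h$, $g\in G$, of the basis vectors. $G$ has the Borsuk–Ulam property if for every $n\ge 1$ every continuous $G$-equivariant map $f:E_NG\to (W_G)^n$ has a zero. $G$ has the Tucker property if for every $n\ge1$, every $G$-invariant subdivision $K$ of $E_NG$ (a finite geometric simplicial complex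 with the same underlying space as $E_NG$, each of whose simplices lies in a simplex of $E_NG$, and such that $g\cdot\sigma\in K$ for all $g\in G$ and $\sigma\in K$) and every $G$-equivariant map $\phi$ from the vertices of $K$ to the vertices of $\Diamond_G^n$, there is a simplex $\sigma\in K$ such that $0$ lies in the convex hull of the labels $\phi(v)$ of the vertices $v$ of $\sigma$. Theorem. If a finite group $G$ has the Tucker property, then it has the Borsuk–Ulam property. The converse also holds, so that the two properties of $G$ are equivalent. -/

import Mathlib

namespace TuckerBU

open Geometry

noncomputable section

/-! ### Borsuk-Ulam pairs and Tucker triples -/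

section General

variable {G E V : Type*} [Group G]
  [AddCommGroup E] [Module ℝ E] [AddCommGroup V] [Module ℝ V]

/-- `K` is a subdivision of the complex `L`: a finite simplicial complex with the same underlying
space, each simplex of which lies in a simplex of `L`. -/
structure IsSubdivision (K L : SimplicialComplex ℝ E) : Prop where
  finite : K.faces.Finite
  space_eq : K.space = L.space
  refines : ∀ s ∈ K.faces, ∃ t ∈ L.faces,
    convexHull ℝ (s : Set E) ⊆ convexHull ℝ (t : Set E)

/-- `K` is `G`-invariant, where `G` acts linearly on the ambient space through `ρ`: if `σ` is a
simplex of `K`, then so is `g • σ`, for every `g`. -/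
def IsInvariant (ρ : Representation ℝ G E) (K : SimplicialComplex ℝ E) : Prop :=
  ∀ g : G, ∀ s ∈ K.faces, ∃ t ∈ K.faces, (t : Set E) = ρ g '' (s : Set E)

/-- `(K, V)` is a Borsuk-Ulam pair for `G`: every continuous `G`-equivariant map from the
underlying space of `K` to `V` has a zero. -/
def IsBorsukUlamPair [TopologicalSpace E] [TopologicalSpace V]
    (ρ : Representation ℝ G E) (K : SimplicialComplex ℝ E) (τ : Representation ℝ G V) : Prop :=
  ∀ f : E → V, ContinuousOn f K.space → (∀ g : G, ∀ x ∈ K.space, f (ρ g x) = τ g (f x)) →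
    ∃ x ∈ K.space, f x = 0

/-- `(K, V, Q)` is a Tucker triple for `G`: for every `G`-equivariant labelling `φ` of the vertices
of `K` by vertices (that is, extreme points) of the polytope `Q ⊆ V` there is a simplex of `K` such
that `0` lies in the convex hull of the labels of its vertices. -/
def IsTuckerTriple (ρ : Representation ℝ G E) (K : SimplicialComplex ℝ E)
    (τ : Representation ℝ G V) (Q : Set V) : Prop :=
  ∀ φ : E → V, (∀ v ∈ K.vertices, φ v ∈ Q.extremePoints ℝ) →
    (∀ g : G, ∀ v ∈ K.vertices, φ (ρ g v) = τ g (φ v)) →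
    ∃ s ∈ K.faces, (0 : V) ∈ convexHull ℝ (φ '' (s : Set E))

end General

/-! ### The complex `E_N G` -/

section Join

variable (G : Type*) [Group G]

/-- The diagonal action of `G` on `ℝ^(G × [m])`, permuting the basis vectors by
`g • e_(h, i) = e_(g * h, i)`. -/
def joinRep (m : ℕ) : Representation ℝ G (G × Fin m → ℝ) where
  toFun g := LinearMap.funLeft ℝ ℝ fun p : G × Fin m => (g⁻¹ * p.1, p.2)
  map_one' := by ext; simp
  map_mul' g h := by ext; simp [mul_assoc, LinearMap.funLeft_apply]

open Classical in
/-- The `m`-fold join of the `0`-dimensional complex `G` with itself, geometrically realized in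
`ℝ^(G × [m])`: the vertices are the standard basis vectors `e_(g, i)`, and a nonempty set of
vertices spans a simplex if it has at most one vertex in each of the `m` copies of `G`. -/
def joinComplex (m : ℕ) : SimplicialComplex ℝ (G × Fin m → ℝ) :=
  SimplicialComplex.ofAffineIndependent
    { faces := {s | ∃ c : Finset (G × Fin m), c.Nonempty ∧ Set.InjOn Prod.snd (c : Set (G × Fin m)) ∧
        s = c.image fun p => (Pi.single p 1 : G × Fin m → ℝ)}
      isRelLowerSet_faces := by
        rintro _ ⟨c, hc, hinj, rfl⟩
        refine ⟨hc.image _, fun t hts ht => ?_⟩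
        obtain ⟨d, hd, rfl⟩ := Finset.subset_image_iff.mp hts
        exact ⟨d, Finset.image_nonempty.mp ht, hinj.mono (by exact_mod_cast hd), rfl⟩ }
    (by
      refine (Pi.linearIndependent_single_one (G × Fin m) ℝ).affineIndependent.range.mono
        fun x hx => ?_
      simp only [Set.mem_iUnion, Finset.mem_coe] at hx
      obtain ⟨_, ⟨c, _, _, rfl⟩, hx⟩ := hx
      obtain ⟨p, _, rfl⟩ := Finset.mem_image.mp hx
      exact ⟨p, rfl⟩)

end Join

/-! ### The representation `(W_G)^n` and the generalized crosspolytope -/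

section Crosspolytope

variable (G : Type*) [Group G] [Fintype G]

/-- The real regular representation `ℝ[G]`, with `g • e_h = e_(g * h)`. -/
def regularRep : Representation ℝ G (G → ℝ) where
  toFun g := LinearMap.funLeft ℝ ℝ fun h : G => g⁻¹ * h
  map_one' := by ext; simp
  map_mul' g h := by ext; simp [mul_assoc, LinearMap.funLeft_apply]

/-- `W_G`, the space of all `x` in `ℝ[G]` whose coordinates sum to `0`. -/
def W : Submodule ℝ (G → ℝ) where
  carrier := {x | ∑ h, x h = 0}
  add_mem' {x y} hx hy := by
    simp only [Set.mem_ofPred_eq] at hx hy ⊢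
    simp [Finset.sum_add_distrib, hx, hy]
  zero_mem' := by simp
  smul_mem' c x hx := by
    simp only [Set.mem_ofPred_eq] at hx ⊢
    simp [← Finset.mul_sum, hx]

/-- `W_G` as a subrepresentation of the regular representation. -/
def wRep : Representation ℝ G (W G) :=
  (regularRep G).subrepresentation (W G) fun g x (hx : ∑ h, x h = 0) =>
    show ∑ h, x (g⁻¹ * h) = 0 from
      (Fintype.sum_equiv (Equiv.mulLeft g⁻¹) _ _ fun _ => rfl).trans hx

/-- The representation `(W_G)^n`, with `G` acting on each of the `n` copies of `W_G`. -/
def wPowRep (n : ℕ) : Representation ℝ G (Fin n → W G) where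
  toFun g := LinearMap.piMap fun _ => wRep G g
  map_one' := by ext; simp
  map_mul' g h := by ext; simp

open Classical in
/-- The orthogonal projection `e_g - (1 / k) ∑ h, e_h` of the basis vector `e_g` of `ℝ[G]` to
`W_G`, where `k` is the order of `G`. -/
def wVertex (g : G) : W G :=
  ⟨fun h => (Pi.single g 1 : G → ℝ) h - 1 / (Fintype.card G : ℝ),
    show ∑ h, ((Pi.single g 1 : G → ℝ) h - 1 / (Fintype.card G : ℝ)) = 0 by
      simp [Finset.sum_sub_distrib]⟩

/-- The generalized crosspolytope in `(W_G)^n`: the convex hull of the union of the simplices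
`Δ_(i)`, where `Δ_(i)` lies in the `i`-th copy of `W_G` and is spanned there by the projections of
the basis vectors of `ℝ[G]`. -/
def crosspolytope (n : ℕ) : Set (Fin n → W G) :=
  convexHull ℝ (⋃ i : Fin n, convexHull ℝ
    (Set.range fun g : G => (Pi.single i (wVertex G g) : Fin n → W G)))

/-! ### The two properties of a finite group -/

/-- The Borsuk-Ulam property of `G`: for `k = |G|`, every `n ≥ 1` and `N = n * (k - 1)`, the pair
`(E_N G, (W_G)^n)` is a Borsuk-Ulam pair, where `E_N G` is the `(N + 1)`-fold join of `G`. -/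
def BorsukUlamProperty : Prop :=
  ∀ n : ℕ, 1 ≤ n →
    IsBorsukUlamPair (joinRep G (n * (Fintype.card G - 1) + 1))
      (joinComplex G (n * (Fintype.card G - 1) + 1)) (wPowRep G n)

/-- The Tucker property of `G`: for `k = |G|`, every `n ≥ 1`, `N = n * (k - 1)` and every
`G`-invariant subdivision `K` of `E_N G`, the triple consisting of `K`, `(W_G)^n` and the
generalized crosspolytope is a Tucker triple. -/
def TuckerProperty : Prop :=
  ∀ n : ℕ, 1 ≤ n →
    ∀ K : SimplicialComplex ℝ (G × Fin (n * (Fintype.card G - 1) + 1) → ℝ),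
      IsSubdivision K (joinComplex G (n * (Fintype.card G - 1) + 1)) →
      IsInvariant (joinRep G (n * (Fintype.card G - 1) + 1)) K →
      IsTuckerTriple (joinRep G (n * (Fintype.card G - 1) + 1)) K (wPowRep G n)
        (crosspolytope G n)

end Crosspolytope

end

end TuckerBU

/-!
If `(K, V)` is a Borsuk-Ulam pair, an equivariant labelling of a subdivision of `K` extends affinely
over each simplex to an equivariant map; the simplex in which this map vanishes is the one Tucker's
lemma asks for.

Conversely, let `f` be equivariant without a zero. By compactness some coordinate of `f x` is at
least a fixed `δ > 0` at each `x`. Since the action on the join is free, the vertices of a fine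
invariant subdivision can be labelled equivariantly by such coordinates `(i, g)`. If `0` is a convex
combination of the labels on a simplex, then for some `i` all the labels `(i, g)` occur, and as the
simplex is small, all coordinates of the `i`-th component of `f` are positive at each of its
vertices, although they sum to `0`.

Fine invariant subdivisions are obtained by pulling back Freudenthal triangulations along partial
sums of coordinates. The vertices of the Freudenthal simplex that carries `x` are the roundings
`⌊x + θ⌋`, `0 ≤ θ < 1`, and its convex hull contains `x` because `∫ ⌊a + θ⌋ dθ = a` over `[0, 1]`.
-/

namespace TuckerBU

open Geometry

/-! ### Piecewise affine extensions -/

section AffineExtension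

theorem exists_affineMap_apply_eq {ι k E V : Type*} [DivisionRing k] [AddCommGroup E] [Module k E]
    [AddCommGroup V] [Module k V] {p : ι → E} (hp : AffineIndependent k p) (φ : ι → V) :
    ∃ A : E →ᵃ[k] V, ∀ i, A (p i) = φ i := by
  rcases isEmpty_or_nonempty ι with _ | ⟨⟨i₀⟩⟩
  · exact ⟨0, isEmptyElim⟩
  have hlin := (affineIndependent_iff_linearIndependent_vsub k p i₀).mp hp
  obtain ⟨L, hL⟩ := LinearMap.exists_extend
    ((Module.Basis.span hlin).constr ℕ fun i => φ i - φ i₀)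
  have hLp (i : ι) : L (p i - p i₀) = φ i - φ i₀ := by
    rcases eq_or_ne i i₀ with rfl | hi
    · simp
    · have h := LinearMap.congr_fun hL (Module.Basis.span hlin ⟨i, hi⟩)
      rwa [Module.Basis.constr_basis, LinearMap.comp_apply, Submodule.subtype_apply,
        Module.Basis.coe_span_apply] at h
  refine ⟨L.toAffineMap + AffineMap.const k E (φ i₀ - L (p i₀)), fun i => ?_⟩
  have := hLp i
  rw [map_sub, sub_eq_iff_eq_add] at this
  simp [this]

variable {E V : Type*} [AddCommGroup E] [Module ℝ E] [AddCommGroup V] [Module ℝ V]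
  {K : SimplicialComplex ℝ E} {φ f : E → V}

/-- `f` extends the values of `φ` at the vertices of `K` affinely to each simplex of `K`. -/
def IsAffineExtension (K : SimplicialComplex ℝ E) (φ f : E → V) : Prop :=
  ∀ s ∈ K.faces, ∃ A : E →ᵃ[ℝ] V, Set.EqOn A φ s ∧ Set.EqOn A f (convexHull ℝ s)

theorem IsAffineExtension.mem_convexHull_image (hf : IsAffineExtension K φ f) {s : Finset E}
    (hs : s ∈ K.faces) {x : E} (hx : x ∈ convexHull ℝ (s : Set E)) :
    f x ∈ convexHull ℝ (φ '' s) := by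
  obtain ⟨A, hAφ, hAf⟩ := hf s hs
  rw [← hAf hx, ← hAφ.image_eq, ← AffineMap.image_convexHull]
  exact Set.mem_image_of_mem A hx

theorem eqOn_convexHull {A B : E →ᵃ[ℝ] V} {s : Set E} (h : Set.EqOn A B s) :
    Set.EqOn A B (convexHull ℝ s) :=
  (AffineMap.eqOn_affineSpan h).mono (convexHull_subset_affineSpan s)

theorem IsAffineExtension.map_apply {G : Type*} [Group G] {ρ : Representation ℝ G E}
    {τ : Representation ℝ G V} (hf : IsAffineExtension K φ f) (hK : IsInvariant ρ K)
    (hφ : ∀ g, ∀ v ∈ K.vertices, φ (ρ g v) = τ g (φ v)) (g : G) {x : E} (hx : x ∈ K.space) :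
    f (ρ g x) = τ g (f x) := by
  obtain ⟨s, hs, hxs⟩ := SimplicialComplex.mem_space_iff.mp hx
  obtain ⟨t, ht, hts⟩ := hK g s hs
  obtain ⟨A, hAφ, hAf⟩ := hf s hs
  obtain ⟨B, hBφ, hBf⟩ := hf t ht
  have hgx : ρ g x ∈ convexHull ℝ (t : Set E) := by
    rw [hts, ← LinearMap.image_convexHull]
    exact Set.mem_image_of_mem _ hxs
  have hBA : Set.EqOn (B.comp (ρ g).toAffineMap) ((τ g).toAffineMap.comp A) s := fun v hv => by
    have hgv : ρ g v ∈ (t : Set E) := hts ▸ Set.mem_image_of_mem _ hv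
    have hvK : v ∈ K.vertices := K.down_closed hs (by simpa using hv) (Finset.singleton_nonempty v)
    simp [hBφ hgv, hAφ hv, hφ g v hvK]
  simpa [hBf hgx, hAf hxs] using eqOn_convexHull hBA hxs

theorem exists_isAffineExtension (K : SimplicialComplex ℝ E) (φ : E → V) :
    ∃ f, IsAffineExtension K φ f := by
  have hext (s : Finset E) (hs : s ∈ K.faces) : ∃ A : E →ᵃ[ℝ] V, Set.EqOn A φ s := by
    obtain ⟨A, hA⟩ := exists_affineMap_apply_eq (K.indep hs) fun v => φ v
    exact ⟨A, fun v hv => hA ⟨v, hv⟩⟩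
  choose! A hA using hext
  choose! S hS hxS using fun x (hx : x ∈ K.space) => SimplicialComplex.mem_space_iff.mp hx
  refine ⟨fun x => A (S x) x, fun s hs => ⟨A s, hA s hs, fun x hx => ?_⟩⟩
  have hxK : x ∈ K.space := K.convexHull_subset_space hs hx
  have hinter : Set.EqOn (A s) (A (S x)) (s ∩ S x) := fun v hv =>
    (hA s hs hv.1).trans (hA _ (hS x hxK) hv.2).symm
  exact eqOn_convexHull hinter (K.inter_subset_convexHull hs (hS x hxK) ⟨hx, hxS x hxK⟩)

variable [TopologicalSpace E] [IsTopologicalAddGroup E] [ContinuousSMul ℝ E] [T2Space E]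
  [TopologicalSpace V] [IsTopologicalAddGroup V] [ContinuousSMul ℝ V]

theorem IsAffineExtension.continuousOn [FiniteDimensional ℝ E] (hf : IsAffineExtension K φ f)
    (hK : K.faces.Finite) : ContinuousOn f K.space := by
  have : Finite K.faces := hK
  have hspace : K.space = ⋃ s : K.faces, convexHull ℝ (s : Set E) := by
    simp [SimplicialComplex.space, Set.iUnion_subtype]
  rw [hspace]
  refine (locallyFinite_of_finite _).continuousOn_iUnion
    (fun s => s.1.finite_toSet.isClosed_convexHull ℝ) fun s => ?_
  obtain ⟨A, -, hAf⟩ := hf s s.2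
  have hA : Continuous A :=
    AffineMap.continuous_linear_iff.mp A.linear.continuous_of_finiteDimensional
  exact hA.continuousOn.congr hAf.symm

theorem IsBorsukUlamPair.isTuckerTriple [FiniteDimensional ℝ E] {G : Type*} [Group G]
    {ρ : Representation ℝ G E} {τ : Representation ℝ G V} {L : SimplicialComplex ℝ E}
    (hL : IsBorsukUlamPair ρ L τ) (hKL : IsSubdivision K L) (hK : IsInvariant ρ K) (Q : Set V) :
    IsTuckerTriple ρ K τ Q := by
  intro φ _ hφ
  obtain ⟨f, hf⟩ := exists_isAffineExtension K φ
  have hzero : ∃ x ∈ K.space, f x = 0 := by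
    rw [hKL.space_eq]
    exact hL f (hKL.space_eq ▸ hf.continuousOn hKL.finite)
      fun g x hx => hf.map_apply hK hφ g (hKL.space_eq ▸ hx)
  obtain ⟨x, hx, hfx⟩ := hzero
  obtain ⟨s, hs, hxs⟩ := SimplicialComplex.mem_space_iff.mp hx
  exact ⟨s, hs, hfx ▸ hf.mem_convexHull_image hs hxs⟩

end AffineExtension

/-! ### The Freudenthal triangulation -/

section Freudenthal

variable {ι : Type*}

/-- The vertex sets of the simplices of the Freudenthal (or Kuhn) triangulation of `ℝ^ι`, whose
vertices are the integral points: chains for the coordinatewise order, with coordinates that vary by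
at most `1`. -/
structure IsKuhnSimplex (s : Set (ι → ℝ)) : Prop where
  integral : ∀ v ∈ s, ∀ i, ∃ k : ℤ, v i = k
  isChain : IsChain (· ≤ ·) s
  le_add_one : ∀ u ∈ s, ∀ v ∈ s, u ≤ v + 1

theorem IsKuhnSimplex.mono {s t : Set (ι → ℝ)} (ht : IsKuhnSimplex t) (hst : s ⊆ t) :
    IsKuhnSimplex s :=
  ⟨fun v hv => ht.integral v (hst hv), ht.isChain.mono hst,
    fun u hu v hv => ht.le_add_one u (hst hu) v (hst hv)⟩

/-- The coordinatewise rounding `⌊x + θ⌋`. -/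
noncomputable def floorAdd (θ : ℝ) (x : ι → ℝ) : ι → ℝ := fun i => ⌊x i + θ⌋

/-- The roundings `⌊x + θ⌋` of `x` with `0 ≤ θ < 1`. They are the vertices of the smallest simplex
of the Freudenthal triangulation that contains `x`. -/
def roundings (x : ι → ℝ) : Set (ι → ℝ) := (floorAdd · x) '' Set.Ico 0 1

theorem isKuhnSimplex_roundings (x : ι → ℝ) : IsKuhnSimplex (roundings x) where
  integral := by
    rintro _ ⟨θ, -, rfl⟩ i
    exact ⟨_, rfl⟩
  isChain := by
    have hmono : Monotone (floorAdd · x) := fun θ η hθη i =>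
      Int.cast_le.mpr (Int.floor_le_floor (by gcongr))
    exact (hmono.isChain_range).mono (Set.image_subset_range _ _)
  le_add_one := by
    rintro _ ⟨θ, hθ, rfl⟩ _ ⟨η, hη, rfl⟩ i
    have h : ⌊x i + θ⌋ ≤ ⌊x i + η⌋ + 1 := by
      rw [← Int.floor_add_one]
      exact Int.floor_le_floor (by linarith [hθ.2, hη.1])
    exact (Int.cast_le.mpr h).trans_eq (Int.cast_add _ _ |>.trans (by simp [floorAdd]))

theorem finite_roundings [Finite ι] (x : ι → ℝ) : (roundings x).Finite := by
  refine (Set.Finite.pi' fun i => ((Set.finite_Icc ⌊x i⌋ (⌊x i⌋ + 1)).image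
    ((↑) : ℤ → ℝ))).subset ?_
  rintro _ ⟨θ, hθ, rfl⟩ i
  refine ⟨⌊x i + θ⌋, ⟨Int.floor_le_floor (by linarith [hθ.1]), ?_⟩, rfl⟩
  rw [← Int.floor_add_one]
  exact Int.floor_le_floor (by linarith [hθ.2])

open Classical in
theorem exists_sum_lt_le_and_lt_sum_le {α : Type*} [PartialOrder α] {s : Finset α}
    (hs : IsChain (· ≤ ·) (s : Set α)) {w : α → ℝ} {θ : ℝ} (hθ₀ : 0 ≤ θ) (hθ₁ : θ < ∑ u ∈ s, w u) :
    ∃ v ∈ s, ∑ u ∈ s with u < v, w u ≤ θ ∧ θ < ∑ u ∈ s with u ≤ v, w u := by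
  induction s using Finset.strongInduction with
  | H s ih =>
    have hne : s.Nonempty := by
      by_contra! rfl
      exact hθ₀.not_gt (by simpa using hθ₁)
    obtain ⟨m, hm⟩ := s.exists_maximal hne
    have hle (u) (hu : u ∈ s) : u ≤ m :=
      (hs.total hu hm.prop).elim id (hm.le_of_ge hu)
    rcases le_or_gt (∑ u ∈ s with u < m, w u) θ with hθm | hθm
    · exact ⟨m, hm.prop, hθm, by rwa [Finset.filter_true_of_mem hle]⟩
    · obtain ⟨v, hv, hlt, hle⟩ := ih (s.filter (· < m))
        (Finset.filter_ssubset.mpr ⟨m, hm.prop, lt_irrefl m⟩)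
        (hs.mono (Finset.coe_subset.mpr (Finset.filter_subset _ _))) hθm
      obtain ⟨hvs, hvm⟩ := Finset.mem_filter.mp hv
      refine ⟨v, hvs, ?_, ?_⟩
      · rwa [Finset.filter_filter,
          Finset.filter_congr fun u _ => and_iff_right_of_imp fun huv => huv.trans hvm] at hlt
      · rwa [Finset.filter_filter,
          Finset.filter_congr fun u _ => and_iff_right_of_imp fun huv => huv.trans_lt hvm] at hle

open Classical in
theorem IsKuhnSimplex.floorAdd_sum_smul {s : Finset (ι → ℝ)}
    (hs : IsKuhnSimplex (s : Set (ι → ℝ))) {w : (ι → ℝ) → ℝ} (hw₀ : ∀ u ∈ s, 0 ≤ w u)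
    (hw₁ : ∑ u ∈ s, w u = 1) {v : ι → ℝ} (hv : v ∈ s) {θ : ℝ}
    (hlow : ∑ u ∈ s with u < v, w u ≤ θ) (hhigh : θ < ∑ u ∈ s with u ≤ v, w u) :
    floorAdd θ (∑ u ∈ s, w u • u) = v := by
  ext i
  obtain ⟨k, hk⟩ := hs.integral v hv i
  have hdiff : (∑ u ∈ s, w u • u) i - v i = ∑ u ∈ s, w u * (u i - v i) := by
    simp [mul_sub, ← Finset.sum_mul, hw₁]
  have hlower : -θ ≤ ∑ u ∈ s, w u * (u i - v i) := by
    refine (neg_le_neg hlow).trans ?_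
    rw [Finset.sum_filter, ← Finset.sum_neg_distrib]
    refine Finset.sum_le_sum fun u hu => ?_
    split_ifs with huv
    · have : v i ≤ u i + 1 := hs.le_add_one v hv u hu i
      nlinarith [hw₀ u hu]
    · have hvu : v ≤ u := (hs.isChain.total hv hu).elim id fun h => (eq_of_le_of_not_lt h huv).ge
      simpa using mul_nonneg (hw₀ u hu) (sub_nonneg.mpr (hvu i))
  have hupper : ∑ u ∈ s, w u * (u i - v i) < 1 - θ := by
    refine lt_of_le_of_lt ?_ (sub_lt_sub_left hhigh 1)
    rw [← hw₁, Finset.sum_filter, ← Finset.sum_sub_distrib]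
    refine Finset.sum_le_sum fun u hu => ?_
    split_ifs with huv
    · simpa using mul_nonpos_of_nonneg_of_nonpos (hw₀ u hu) (sub_nonpos.mpr (huv i))
    · have : u i ≤ v i + 1 := hs.le_add_one u hu v hv i
      nlinarith [hw₀ u hu]
  have hfloor : ⌊(∑ u ∈ s, w u • u) i + θ⌋ = k := by
    rw [Int.floor_eq_iff, ← hk]
    constructor <;> linarith
  rw [floorAdd, hfloor, hk]

theorem IsKuhnSimplex.roundings_subset {s : Set (ι → ℝ)} (hs : IsKuhnSimplex s) {x : ι → ℝ}
    (hx : x ∈ convexHull ℝ s) : roundings x ⊆ s := by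
  rintro _ ⟨θ, hθ, rfl⟩
  rw [convexHull_eq_union_convexHull_finite_subsets] at hx
  obtain ⟨t, hts, hxt⟩ := Set.mem_iUnion₂.mp hx
  obtain ⟨w, hw₀, hw₁, rfl⟩ := Finset.mem_convexHull'.mp hxt
  have ht := hs.mono hts
  -- Rounding with shift `θ` picks out the `θ`-quantile of the weights along the chain.
  obtain ⟨v, hv, hlow, hhigh⟩ := exists_sum_lt_le_and_lt_sum_le ht.isChain hθ.1 (hw₁.symm ▸ hθ.2)
  have hfloor := ht.floorAdd_sum_smul hw₀ hw₁ hv hlow hhigh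
  exact hts (hfloor.symm ▸ hv : floorAdd θ _ ∈ t)

theorem intervalIntegrable_floor_add (a : ℝ) :
    IntervalIntegrable (fun θ : ℝ => (⌊a + θ⌋ : ℝ)) MeasureTheory.volume 0 1 := by
  have hmono : Monotone fun θ : ℝ => (⌊a + θ⌋ : ℝ) := fun θ η hθη =>
    Int.cast_le.mpr (Int.floor_le_floor (by gcongr))
  exact hmono.intervalIntegrable

theorem integral_floor_add (a : ℝ) : ∫ θ in (0 : ℝ)..1, (⌊a + θ⌋ : ℝ) = a := by
  have hfract (b : ℝ) : ∫ θ in (0 : ℝ)..1, Int.fract (b + θ) = ∫ θ in (0 : ℝ)..1, Int.fract θ := by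
    rw [intervalIntegral.integral_comp_add_left fun θ => Int.fract θ]
    simpa using (Int.fract_periodic ℝ).intervalIntegral_add_eq b 0
  have hfract₀ : ∫ θ in (0 : ℝ)..1, Int.fract θ = 1 / 2 := by
    rw [intervalIntegral.integral_congr_Ioo_of_le (f := Int.fract) (g := id) zero_le_one fun θ hθ =>
      Int.fract_eq_self.mpr ⟨hθ.1.le, hθ.2⟩]
    simp
  have hintegrable : IntervalIntegrable (fun θ : ℝ => a + θ) MeasureTheory.volume 0 1 :=
    (by fun_prop : Continuous fun θ : ℝ => a + θ).intervalIntegrable 0 1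
  have hsub : ∫ θ in (0 : ℝ)..1, Int.fract (a + θ) =
      (∫ θ in (0 : ℝ)..1, (a + θ)) - ∫ θ in (0 : ℝ)..1, (⌊a + θ⌋ : ℝ) := by
    rw [← intervalIntegral.integral_sub hintegrable (intervalIntegrable_floor_add a)]
    rfl
  rw [hfract, hfract₀] at hsub
  have hlin : ∫ θ in (0 : ℝ)..1, (a + θ) = a + 1 / 2 := by
    rw [intervalIntegral.integral_add (by simp) (by simp)]
    simp
  linarith

open MeasureTheory in
theorem mem_convexHull_roundings [Finite ι] (x : ι → ℝ) : x ∈ convexHull ℝ (roundings x) := by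
  have := Fintype.ofFinite ι
  have hintegrable (i : ι) :
      Integrable (fun θ => floorAdd θ x i) (volume.restrict (Set.Ioc (0 : ℝ) 1)) :=
    (intervalIntegrable_iff_integrableOn_Ioc_of_le zero_le_one).mp
      (intervalIntegrable_floor_add (x i))
  have hmean : ∫ θ in Set.Ico (0 : ℝ) 1, floorAdd θ x = x := by
    rw [integral_Ico_eq_integral_Ioc]
    ext i
    rw [eval_integral hintegrable]
    simpa [floorAdd, intervalIntegral.integral_of_le] using integral_floor_add (x i)
  have hprob : IsProbabilityMeasure (volume.restrict (Set.Ico (0 : ℝ) 1)) := ⟨by simp⟩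
  rw [← restrict_Ico_eq_restrict_Ioc] at hintegrable
  have hmem : ∀ᵐ θ ∂volume.restrict (Set.Ico (0 : ℝ) 1),
      floorAdd θ x ∈ convexHull ℝ (roundings x) :=
    ae_restrict_of_forall_mem measurableSet_Ico fun θ hθ =>
      subset_convexHull ℝ _ (Set.mem_image_of_mem _ hθ)
  have hmean_mem := (convex_convexHull ℝ _).integral_mem
    ((finite_roundings x).isClosed_convexHull ℝ) hmem (Integrable.of_eval hintegrable)
  rwa [hmean] at hmean_mem

theorem IsKuhnSimplex.convexHull_inter_convexHull_subset [Finite ι] {s t : Set (ι → ℝ)}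
    (hs : IsKuhnSimplex s) (ht : IsKuhnSimplex t) :
    convexHull ℝ s ∩ convexHull ℝ t ⊆ convexHull ℝ (s ∩ t) := fun x ⟨hxs, hxt⟩ =>
  convexHull_mono (Set.subset_inter (hs.roundings_subset hxs) (ht.roundings_subset hxt))
    (mem_convexHull_roundings x)

end Freudenthal

/-! ### Pulling back the Freudenthal triangulation -/

section Pullback

theorem affineIndependent_of_convexHull_inter_subset {𝕜 E : Type*} [Field 𝕜] [LinearOrder 𝕜]
    [IsStrictOrderedRing 𝕜] [AddCommGroup E] [Module 𝕜 E] {s : Set E}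
    (h : ∀ t ⊆ s, ∀ u ⊆ s, convexHull 𝕜 t ∩ convexHull 𝕜 u ⊆ convexHull 𝕜 (t ∩ u)) :
    AffineIndependent 𝕜 ((↑) : s → E) := by
  by_contra hs
  obtain ⟨I, hI⟩ := Convex.radon_partition hs
  obtain ⟨x, hx⟩ := hI.mono
    (h _ (Subtype.coe_image_subset s I) _ (Subtype.coe_image_subset s Iᶜ))
  rw [← Set.image_inter Subtype.val_injective, Set.inter_compl_self, Set.image_empty,
    convexHull_empty] at hx
  exact hx

theorem IsInvariant.map_mem_space {G E : Type*} [Group G] [AddCommGroup E] [Module ℝ E]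
    {ρ : Representation ℝ G E} {K : SimplicialComplex ℝ E} (hK : IsInvariant ρ K) (g : G) {x : E}
    (hx : x ∈ K.space) : ρ g x ∈ K.space := by
  obtain ⟨s, hs, hxs⟩ := SimplicialComplex.mem_space_iff.mp hx
  obtain ⟨t, ht, hts⟩ := hK g s hs
  refine SimplicialComplex.mem_space_iff.mpr ⟨t, ht, ?_⟩
  rw [hts, ← LinearMap.image_convexHull]
  exact Set.mem_image_of_mem _ hxs

variable {E ι : Type*} [AddCommGroup E] [Module ℝ E] [Finite ι] {T : E →ₗ[ℝ] ι → ℝ}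
  {hT : Function.Injective T}

theorem convexHull_inter_convexHull_subset_of_isKuhnSimplex_image (hT : Function.Injective T)
    {s t : Set E} (hs : IsKuhnSimplex (T '' s)) (ht : IsKuhnSimplex (T '' t)) :
    convexHull ℝ s ∩ convexHull ℝ t ⊆ convexHull ℝ (s ∩ t) := by
  rw [← Set.image_subset_image_iff hT, Set.image_inter hT]
  simp only [LinearMap.image_convexHull]
  rw [Set.image_inter hT]
  exact hs.convexHull_inter_convexHull_subset ht

/-- The pullback of the Freudenthal triangulation along an injective linear map `T`, restricted to
the simplices that meet `X`: the vertices of a simplex are points that `T` maps to roundings of the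
image of a common point of `X`. -/
def kuhnComplex (T : E →ₗ[ℝ] ι → ℝ) (hT : Function.Injective T) (X : Set E) :
    SimplicialComplex ℝ E where
  faces := {s | s.Nonempty ∧ ∃ x ∈ X, T '' s ⊆ roundings (T x)}
  isRelLowerSet_faces := fun _ ⟨hne, x, hx, hs⟩ =>
    ⟨hne, fun _ hts ht => ⟨ht, x, hx, (Set.image_mono (Finset.coe_subset.mpr hts)).trans hs⟩⟩
  indep := fun ⟨_, _, _, hs⟩ => affineIndependent_of_convexHull_inter_subset fun _ ht _ hu =>
    convexHull_inter_convexHull_subset_of_isKuhnSimplex_image hT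
      ((isKuhnSimplex_roundings _).mono ((Set.image_mono ht).trans hs))
      ((isKuhnSimplex_roundings _).mono ((Set.image_mono hu).trans hs))
  inter_subset_convexHull := fun ⟨_, _, _, hs⟩ ⟨_, _, _, ht⟩ =>
    convexHull_inter_convexHull_subset_of_isKuhnSimplex_image hT
      ((isKuhnSimplex_roundings _).mono hs) ((isKuhnSimplex_roundings _).mono ht)

variable {X : Set E}

theorem isKuhnSimplex_image_of_mem_kuhnComplex_faces {s : Finset E}
    (hs : s ∈ (kuhnComplex T hT X).faces) : IsKuhnSimplex (T '' s) := by
  obtain ⟨-, x, -, hsx⟩ := hs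
  exact (isKuhnSimplex_roundings _).mono hsx

theorem mem_kuhnComplex_space {x : E} (hx : x ∈ X)
    (hround : roundings (T x) ⊆ Set.range T) : x ∈ (kuhnComplex T hT X).space := by
  have hfin : (T ⁻¹' roundings (T x)).Finite :=
    (finite_roundings (T x)).preimage hT.injOn
  have himage : T '' (T ⁻¹' roundings (T x)) = roundings (T x) :=
    Set.image_preimage_eq_of_subset hround
  have hxhull : x ∈ convexHull ℝ (T ⁻¹' roundings (T x)) := by
    rw [← hT.mem_set_image, LinearMap.image_convexHull, himage]
    exact mem_convexHull_roundings (T x)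
  refine SimplicialComplex.mem_space_iff.mpr ⟨hfin.toFinset, ⟨?_, x, hx, ?_⟩, ?_⟩
  · exact hfin.toFinset_nonempty.mpr (convexHull_nonempty_iff.mp ⟨x, hxhull⟩)
  · rw [hfin.coe_toFinset, himage]
  · rwa [hfin.coe_toFinset]

theorem finite_biUnion_roundings {Y : Set (ι → ℝ)} (hY : Bornology.IsBounded Y) :
    (⋃ y ∈ Y, roundings y).Finite := by
  have := Fintype.ofFinite ι
  obtain ⟨C, hC⟩ := hY.exists_norm_le
  refine (Set.Finite.pi' fun _ : ι => (Set.finite_Icc ⌊-C⌋ ⌊C + 1⌋).image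
    ((↑) : ℤ → ℝ)).subset ?_
  refine Set.iUnion₂_subset fun y hy => ?_
  rintro _ ⟨θ, hθ, rfl⟩ i
  have hyi := abs_le.mp ((norm_le_pi_norm y i).trans (hC y hy))
  exact ⟨⌊y i + θ⌋, ⟨Int.floor_le_floor (by linarith [hθ.1]),
    Int.floor_le_floor (by linarith [hθ.2])⟩, rfl⟩

theorem finite_kuhnComplex_faces (hX : Bornology.IsBounded (T '' X)) :
    (kuhnComplex T hT X).faces.Finite := by
  have hvertices := (finite_biUnion_roundings hX).preimage hT.injOn
  refine Set.Finite.subset (hvertices.finite_subsets.preimage Finset.coe_injective.injOn) ?_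
  rintro s ⟨-, x, hx, hs⟩ v hv
  exact Set.mem_biUnion (Set.mem_image_of_mem T hx) (hs (Set.mem_image_of_mem T hv))

theorem isSubdivision_kuhnComplex {L : SimplicialComplex ℝ E} (hL : L.faces.Finite)
    (hround : ∀ t ∈ L.faces, ∀ x ∈ convexHull ℝ (t : Set E),
      roundings (T x) ⊆ T '' convexHull ℝ t) :
    IsSubdivision (kuhnComplex T hT L.space) L := by
  have := Fintype.ofFinite ι
  have hbounded : Bornology.IsBounded (T '' L.space) := by
    rw [SimplicialComplex.space, Set.image_iUnion₂]
    refine (Bornology.isBounded_biUnion hL).mpr fun t _ => ?_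
    rw [LinearMap.image_convexHull, isBounded_convexHull]
    exact (t.finite_toSet.image T).isBounded
  have hcarried (s) (hs : s ∈ (kuhnComplex T hT L.space).faces) :
      ∃ t ∈ L.faces, convexHull ℝ (s : Set E) ⊆ convexHull ℝ t := by
    obtain ⟨-, x, hx, hsx⟩ := hs
    obtain ⟨t, ht, hxt⟩ := SimplicialComplex.mem_space_iff.mp hx
    refine ⟨t, ht, convexHull_min ?_ (convex_convexHull ℝ _)⟩
    exact (Set.image_subset_image_iff hT).mp (hsx.trans (hround t ht x hxt))
  refine ⟨finite_kuhnComplex_faces hbounded, Set.Subset.antisymm ?_ fun x hx => ?_, hcarried⟩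
  · refine Set.iUnion₂_subset fun s hs => ?_
    obtain ⟨t, ht, hst⟩ := hcarried s hs
    exact hst.trans (L.convexHull_subset_space ht)
  · obtain ⟨t, ht, hxt⟩ := SimplicialComplex.mem_space_iff.mp hx
    exact mem_kuhnComplex_space hx ((hround t ht x hxt).trans (Set.image_subset_range _ _))

theorem isInvariant_kuhnComplex {G : Type*} [Group G] {ρ : Representation ℝ G E}
    (hX : ∀ g, ∀ x ∈ X, ρ g x ∈ X) (hρ : ∀ g, ∃ σ : ι → ι, ∀ x, T (ρ g x) = T x ∘ σ) :
    IsInvariant ρ (kuhnComplex T hT X) := by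
  classical
  rintro g s ⟨hne, x, hx, hsx⟩
  obtain ⟨σ, hσ⟩ := hρ g
  refine ⟨s.image (ρ g), ⟨hne.image _, ρ g x, hX g x hx, ?_⟩, Finset.coe_image⟩
  rw [Finset.coe_image]
  rintro _ ⟨_, ⟨v, hv, rfl⟩, rfl⟩
  obtain ⟨θ, hθ, hvθ⟩ := hsx (Set.mem_image_of_mem T hv)
  exact ⟨θ, hθ, by rw [hσ, hσ, ← hvθ]; rfl⟩

end Pullback

/-! ### Fine invariant subdivisions of the join -/

section Join

theorem mem_convexHull_single_image_iff {ι : Type*} [Fintype ι] [DecidableEq ι] {c : Set ι}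
    {x : ι → ℝ} :
    x ∈ convexHull ℝ ((fun p => (Pi.single p 1 : ι → ℝ)) '' c) ↔
      x ∈ stdSimplex ℝ ι ∧ ∀ p ∉ c, x p = 0 := by
  classical
  constructor
  · have hconv : Convex ℝ {x : ι → ℝ | ∀ p ∉ c, x p = 0} := fun x hx y hy a b _ _ _ p hp => by
      simp [hx p hp, hy p hp]
    refine fun hx => convexHull_min ?_ ((convex_stdSimplex ℝ ι).inter hconv) hx
    rintro _ ⟨q, hq, rfl⟩
    exact ⟨single_mem_stdSimplex ℝ q,
      fun p hp => Pi.single_eq_of_ne (ne_of_mem_of_not_mem hq hp).symm 1⟩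
  · rintro ⟨⟨hx₀, hx₁⟩, hxc⟩
    have hsum : ∑ p with p ∈ c, x p = 1 := by
      rw [Finset.sum_filter_of_ne fun p _ hp => not_imp_comm.mp (hxc p) hp, hx₁]
    have hx : ∑ p with p ∈ c, x p • (Pi.single p 1 : ι → ℝ) = x := by
      rw [Finset.sum_filter_of_ne fun p _ hp =>
        not_imp_comm.mp (hxc p) (left_ne_zero_of_smul hp), ← pi_eq_sum_univ']
    rw [← hx]
    refine (convex_convexHull ℝ _).sum_mem (fun p _ => hx₀ p) hsum fun p hp => ?_
    exact subset_convexHull ℝ _ (Set.mem_image_of_mem _ (Finset.mem_filter.mp hp).2)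

open Classical in
theorem exists_coe_eq_single_image {G : Type*} [Group G] {M : ℕ} {s : Finset (G × Fin M → ℝ)}
    (hs : s ∈ (joinComplex G M).faces) :
    ∃ c : Finset (G × Fin M), Set.InjOn Prod.snd (c : Set (G × Fin M)) ∧
      (s : Set (G × Fin M → ℝ)) = (fun p => Pi.single p 1) '' (c : Set (G × Fin M)) := by
  obtain ⟨c, -, hc, rfl⟩ := hs
  exact ⟨c, hc, Finset.coe_image⟩

theorem finite_joinComplex_faces (G : Type*) [Group G] [Finite G] (M : ℕ) :
    (joinComplex G M).faces.Finite := by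
  classical
  refine (Set.finite_range fun c : Finset (G × Fin M) =>
    c.image fun p => (Pi.single p 1 : G × Fin M → ℝ)).subset ?_
  rintro _ ⟨c, -, -, rfl⟩
  exact ⟨c, by congr!⟩

theorem mem_stdSimplex_and_injOn_support_of_mem_joinComplex_space {G : Type*} [Group G]
    [Fintype G] {M : ℕ} {x : G × Fin M → ℝ} (hx : x ∈ (joinComplex G M).space) :
    x ∈ stdSimplex ℝ (G × Fin M) ∧ Set.InjOn Prod.snd (Function.support x) := by
  classical
  obtain ⟨s, hs, hxs⟩ := SimplicialComplex.mem_space_iff.mp hx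
  obtain ⟨c, hc, hsc⟩ := exists_coe_eq_single_image hs
  rw [hsc, mem_convexHull_single_image_iff] at hxs
  exact ⟨hxs.1, hc.mono fun p hp => not_imp_comm.mp (hxs.2 p) hp⟩

section Action

variable {G : Type*} [Group G] {M : ℕ}

theorem joinRep_apply (g : G) (x : G × Fin M → ℝ) (p : G × Fin M) :
    joinRep G M g x p = x (g⁻¹ * p.1, p.2) := rfl

open Classical in
theorem joinRep_single (g : G) (p : G × Fin M) :
    joinRep G M g (Pi.single p 1) = Pi.single (g * p.1, p.2) 1 := by
  ext q
  simp [joinRep_apply, Pi.single_apply, Prod.ext_iff, inv_mul_eq_iff_eq_mul]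

theorem isInvariant_joinComplex : IsInvariant (joinRep G M) (joinComplex G M) := by
  classical
  rintro g _ ⟨c, hc, hinj, rfl⟩
  refine ⟨_, ⟨c.image fun p => (g * p.1, p.2), hc.image _, ?_, rfl⟩, ?_⟩
  · rw [Finset.coe_image]
    rintro _ ⟨p, hp, rfl⟩ _ ⟨q, hq, rfl⟩ hpq
    rw [hinj hp hq hpq]
  · simp only [Finset.coe_image, Set.image_image, joinRep_single]

theorem eq_one_of_joinRep_eq [Finite G] {x : G × Fin M → ℝ} (hx : x ∈ (joinComplex G M).space)
    {g : G} (hgx : joinRep G M g x = x) : g = 1 := by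
  have := Fintype.ofFinite G
  obtain ⟨⟨-, hx₁⟩, hinj⟩ := mem_stdSimplex_and_injOn_support_of_mem_joinComplex_space hx
  obtain ⟨⟨k, i⟩, -, hk⟩ := Finset.exists_ne_zero_of_sum_ne_zero (hx₁.trans_ne one_ne_zero)
  have hgk : x (g⁻¹ * k, i) ≠ 0 := by
    have := congrFun hgx (k, i)
    rwa [← this] at hk
  simpa using hinj hgk hk rfl

end Action

variable {G : Type*} [Fintype G] {M : ℕ}

/-- The sum of the coordinates of `x` in the first `i` copies of `G`. -/
noncomputable def partialSum (i : ℕ) : (G × Fin M → ℝ) →ₗ[ℝ] ℝ :=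
  ∑ j ∈ Finset.univ.filter fun j : Fin M => (j : ℕ) < i, ∑ g : G, LinearMap.proj (g, j)

theorem partialSum_zero (x : G × Fin M → ℝ) : partialSum 0 x = 0 := by
  simp [partialSum]

theorem partialSum_last (x : G × Fin M → ℝ) : partialSum M x = ∑ p, x p := by
  simp [partialSum, Fintype.sum_prod_type_right]

theorem partialSum_succ (i : Fin M) (x : G × Fin M → ℝ) :
    partialSum (i + 1) x = partialSum i x + ∑ g, x (g, i) := by
  have hinsert : Finset.univ.filter (fun j : Fin M => (j : ℕ) < i + 1) =
      insert i (Finset.univ.filter fun j : Fin M => (j : ℕ) < i) := by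
    ext j
    simp [le_iff_eq_or_lt, Fin.ext_iff]
  rw [partialSum, hinsert, Finset.sum_insert (by simp), add_comm]
  simp [partialSum]

/-- The linear map whose entry at `(none, i)` is the sum of the coordinates of `x` in the copies of
`G` before the `i`-th one, and whose entry at `(some g, i)` is that sum plus the coordinate at
`(g, i)`. On a simplex of the join these are partial sums `0 ≤ y₁ ≤ ⋯ ≤ y_r = 1` of barycentric
coordinates, so rounding them all to multiples of `1 / m` with the same shift preserves the
simplex. -/
noncomputable def cumulativeSum : (G × Fin M → ℝ) →ₗ[ℝ] (Option G × Fin M → ℝ) :=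
  LinearMap.pi fun q => partialSum q.2 + q.1.elim 0 fun g => LinearMap.proj (g, q.2)

theorem cumulativeSum_none (x : G × Fin M → ℝ) (i : Fin M) :
    cumulativeSum x (none, i) = partialSum i x := by
  simp [cumulativeSum]

theorem cumulativeSum_some (x : G × Fin M → ℝ) (g : G) (i : Fin M) :
    cumulativeSum x (some g, i) = partialSum i x + x (g, i) := rfl

theorem cumulativeSum_some_sub_none (x : G × Fin M → ℝ) (p : G × Fin M) :
    cumulativeSum x (some p.1, p.2) - cumulativeSum x (none, p.2) = x p := by
  rw [cumulativeSum_some, cumulativeSum_none, add_sub_cancel_left]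

theorem cumulativeSum_joinRep [Group G] (g : G) (x : G × Fin M → ℝ) :
    cumulativeSum (joinRep G M g x) =
      cumulativeSum x ∘ Prod.map (Option.map (g⁻¹ * ·)) id := by
  have hpartial (i : ℕ) : partialSum i (joinRep G M g x) = partialSum i x := by
    simp only [partialSum, LinearMap.sum_apply, LinearMap.proj_apply]
    exact Finset.sum_congr rfl fun j _ => Fintype.sum_equiv (Equiv.mulLeft g⁻¹) _ _ fun _ => rfl
  ext ⟨_ | h, i⟩
  · simp [cumulativeSum_none, hpartial]
  · simp [cumulativeSum_some, hpartial, joinRep_apply]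

/-- The point with coordinates in `(1 / m) ℤ` that is obtained from `x` by applying
`⌊m * · + θ⌋ / m` to its cumulative sums. -/
noncomputable def gridPoint (m : ℕ) (θ : ℝ) (x : G × Fin M → ℝ) : G × Fin M → ℝ := fun p =>
  ((⌊m * (partialSum p.2 x + x p) + θ⌋ : ℝ) - ⌊m * partialSum p.2 x + θ⌋) / m

theorem gridPoint_eq_zero (m : ℕ) (θ : ℝ) {x : G × Fin M → ℝ} {p : G × Fin M} (hp : x p = 0) :
    gridPoint m θ x p = 0 := by
  simp [gridPoint, hp]

theorem gridPoint_nonneg (m : ℕ) (θ : ℝ) {x : G × Fin M → ℝ} {p : G × Fin M} (hp : 0 ≤ x p) :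
    0 ≤ gridPoint m θ x p := by
  refine div_nonneg (sub_nonneg.mpr (Int.cast_le.mpr (Int.floor_le_floor ?_))) m.cast_nonneg
  gcongr
  exact le_add_of_nonneg_right hp

theorem sum_comp_eq_comp_sum {α A B : Type*} [Fintype α] [AddCommMonoid A] [AddCommMonoid B]
    {F : A → B} (hF : F 0 = 0) {x : α → A} (hx : (Function.support x).Subsingleton) :
    ∑ a, F (x a) = F (∑ a, x a) := by
  rcases hx.eq_empty_or_singleton with h | ⟨a, h⟩
  · simp [Function.support_eq_empty_iff.mp h, hF]
  · have hx₀ (b) (hb : b ≠ a) : x b = 0 :=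
      Function.notMem_support.mp (by rwa [h])
    rw [Fintype.sum_eq_single a fun b hb => by rw [hx₀ b hb, hF], Fintype.sum_eq_single a hx₀]

variable {m : ℕ} {θ : ℝ} {x : G × Fin M → ℝ}

theorem partialSum_gridPoint (hm : m ≠ 0) (hθ : θ ∈ Set.Ico (0 : ℝ) 1)
    (hx : Set.InjOn Prod.snd (Function.support x)) {i : ℕ} (hi : i ≤ M) :
    m * partialSum i (gridPoint m θ x) = ⌊m * partialSum i x + θ⌋ := by
  induction i with
  | zero => simp [partialSum_zero, Int.floor_eq_zero_iff.mpr hθ]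
  | succ i ih =>
    have hsubsingleton : (Function.support fun g => x (g, ⟨i, hi⟩)).Subsingleton :=
      fun g hg h hh => congrArg Prod.fst (hx hg hh rfl)
    have hsum := sum_comp_eq_comp_sum
      (F := fun y => ((⌊m * (partialSum i x + y) + θ⌋ : ℝ) - ⌊m * partialSum i x + θ⌋) / m)
      (by simp) hsubsingleton
    have hcopy : ∑ g, gridPoint m θ x (g, ⟨i, hi⟩) =
        ((⌊m * partialSum (i + 1) x + θ⌋ : ℝ) - ⌊m * partialSum i x + θ⌋) / m := by
      rw [partialSum_succ ⟨i, hi⟩ x, ← hsum]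
      rfl
    rw [partialSum_succ ⟨i, hi⟩, mul_add, ih (Nat.le_of_succ_le hi), hcopy]
    field_simp
    ring

theorem cumulativeSum_gridPoint (hm : m ≠ 0) (hθ : θ ∈ Set.Ico (0 : ℝ) 1)
    (hx : Set.InjOn Prod.snd (Function.support x)) :
    (m : ℝ) • cumulativeSum (gridPoint m θ x) = floorAdd θ ((m : ℝ) • cumulativeSum x) := by
  ext ⟨_ | g, i⟩
  · simp [floorAdd, cumulativeSum_none, partialSum_gridPoint hm hθ hx i.2.le]
  · simp only [Pi.smul_apply, smul_eq_mul, cumulativeSum_some, gridPoint, mul_add,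
      partialSum_gridPoint hm hθ hx i.2.le, floorAdd]
    field_simp
    ring

theorem gridPoint_mem_stdSimplex (hm : m ≠ 0) (hθ : θ ∈ Set.Ico (0 : ℝ) 1)
    (hx : x ∈ stdSimplex ℝ (G × Fin M)) (hinj : Set.InjOn Prod.snd (Function.support x)) :
    gridPoint m θ x ∈ stdSimplex ℝ (G × Fin M) := by
  refine ⟨fun p => gridPoint_nonneg m θ (hx.1 p), ?_⟩
  have hsum := partialSum_gridPoint hm hθ hinj le_rfl
  rw [partialSum_last, partialSum_last, hx.2, mul_one, Int.floor_natCast_add,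
    Int.floor_eq_zero_iff.mpr hθ, add_zero, Int.cast_natCast] at hsum
  exact (mul_eq_left₀ (Nat.cast_ne_zero.mpr hm)).mp hsum

theorem roundings_cumulativeSum_subset [Group G] (hm : m ≠ 0) {t : Finset (G × Fin M → ℝ)}
    (ht : t ∈ (joinComplex G M).faces) (hx : x ∈ convexHull ℝ (t : Set (G × Fin M → ℝ))) :
    roundings ((m : ℝ) • cumulativeSum x) ⊆ ((m : ℝ) • cumulativeSum) '' convexHull ℝ t := by
  classical
  rintro _ ⟨θ, hθ, rfl⟩
  obtain ⟨hxΔ, hinj⟩ := mem_stdSimplex_and_injOn_support_of_mem_joinComplex_space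
    ((joinComplex G M).convexHull_subset_space ht hx)
  obtain ⟨c, -, htc⟩ := exists_coe_eq_single_image ht
  refine ⟨gridPoint m θ x, ?_, cumulativeSum_gridPoint hm hθ hinj⟩
  rw [htc, mem_convexHull_single_image_iff] at hx ⊢
  exact ⟨gridPoint_mem_stdSimplex hm hθ hxΔ hinj, fun p hp => gridPoint_eq_zero m θ (hx.2 p hp)⟩

theorem injective_smul_cumulativeSum (hm : m ≠ 0) :
    Function.Injective ((m : ℝ) • cumulativeSum (G := G) (M := M)) := by
  refine (smul_right_injective _ (Nat.cast_ne_zero.mpr hm : (m : ℝ) ≠ 0)).comp fun x y hxy => ?_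
  ext p
  rw [← cumulativeSum_some_sub_none x, ← cumulativeSum_some_sub_none y, hxy]

theorem dist_le_of_isKuhnSimplex (hm : m ≠ 0) {s : Set (G × Fin M → ℝ)}
    (hs : IsKuhnSimplex (((m : ℝ) • cumulativeSum (G := G) (M := M)) '' s)) {u v : G × Fin M → ℝ}
    (hu : u ∈ s) (hv : v ∈ s) : dist u v ≤ 2 / m := by
  have hm₀ : (0 : ℝ) < m := by positivity
  refine (dist_pi_le_iff (by positivity)).mpr fun p => ?_
  have huv := hs.le_add_one _ (Set.mem_image_of_mem _ hu) _ (Set.mem_image_of_mem _ hv)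
  have hvu := hs.le_add_one _ (Set.mem_image_of_mem _ hv) _ (Set.mem_image_of_mem _ hu)
  simp only [Pi.le_def, LinearMap.smul_apply, Pi.smul_apply, Pi.add_apply, Pi.one_apply,
    smul_eq_mul] at huv hvu
  rw [Real.dist_eq, le_div_iff₀' hm₀, ← abs_of_pos hm₀, ← abs_mul,
    ← cumulativeSum_some_sub_none u, ← cumulativeSum_some_sub_none v, abs_le]
  constructor <;> linarith [huv (some p.1, p.2), huv (none, p.2), hvu (some p.1, p.2),
    hvu (none, p.2)]

theorem exists_fine_invariant_subdivision (G : Type*) [Group G] [Fintype G] (M : ℕ) {ε : ℝ}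
    (hε : 0 < ε) : ∃ K : SimplicialComplex ℝ (G × Fin M → ℝ), IsSubdivision K (joinComplex G M) ∧
      IsInvariant (joinRep G M) K ∧ ∀ s ∈ K.faces, ∀ u ∈ s, ∀ v ∈ s, dist u v < ε := by
  obtain ⟨m, hm⟩ := exists_nat_gt (2 / ε)
  have hm₀ : (0 : ℝ) < m := lt_trans (by positivity) hm
  have hm' : m ≠ 0 := by rintro rfl; simp at hm₀
  refine ⟨kuhnComplex ((m : ℝ) • cumulativeSum) (injective_smul_cumulativeSum hm')
    (joinComplex G M).space, isSubdivision_kuhnComplex (finite_joinComplex_faces G M)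
      fun t ht x hx => roundings_cumulativeSum_subset hm' ht hx,
    isInvariant_kuhnComplex (fun g x hx => isInvariant_joinComplex.map_mem_space g hx)
      fun g => ⟨Prod.map (Option.map (g⁻¹ * ·)) id, fun x => ?_⟩, fun s hs u hu v hv => ?_⟩
  · simp only [LinearMap.smul_apply, cumulativeSum_joinRep]
    rfl
  · exact (dist_le_of_isKuhnSimplex hm' (isKuhnSimplex_image_of_mem_kuhnComplex_faces hs)
      hu hv).trans_lt ((div_lt_comm₀ hm₀ hε).mpr hm)

end Join

/-! ### Vertices of the crosspolytope -/

section Crosspolytope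

theorem mem_extremePoints_convexHull_insert {V : Type*} [AddCommGroup V] [Module ℝ V] {S : Set V}
    {u : V} (ℓ : V →ₗ[ℝ] ℝ) (hℓ : ∀ v ∈ S, ℓ v < ℓ u) :
    u ∈ (convexHull ℝ (insert u S)).extremePoints ℝ := by
  rcases S.eq_empty_or_nonempty with rfl | hS
  · simp
  rw [(convex_convexHull ℝ _).mem_extremePoints_iff_convex_sdiff]
  refine ⟨subset_convexHull ℝ _ (Set.mem_insert u S), ?_⟩
  suffices hdiff : convexHull ℝ (insert u S) \ {u} = convexHull ℝ (insert u S) ∩ {v | ℓ v < ℓ u} by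
    rw [hdiff]
    exact (convex_convexHull ℝ _).inter (convex_halfSpace_lt ℓ.isLinear _)
  refine Set.ext fun v => and_congr_right fun hv => ⟨fun hne => ?_, fun hlt heq => ?_⟩
  · rw [convexHull_insert hS, convexJoin_singleton_left, Set.mem_iUnion₂] at hv
    obtain ⟨w, hw, a, b, -, hb, hab, rfl⟩ := hv
    have hw : ℓ w < ℓ u := convexHull_min hℓ (convex_halfSpace_lt ℓ.isLinear _) hw
    have hb₀ : b ≠ 0 := by
      rintro rfl
      rw [add_zero] at hab
      exact hne (by simp [hab])
    have hdecrease := mul_lt_mul_of_pos_left hw (hb.lt_of_ne' hb₀)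
    rw [Set.mem_ofPred_eq, map_add, map_smul, map_smul, smul_eq_mul, smul_eq_mul]
    linear_combination hdecrease + hab * ℓ u
  · exact hlt.ne (congrArg ℓ heq)

/-- The coordinate of a point of `(W_G)^n` with index `p.2` in the copy of `W_G` with index
`p.1`. -/
def coord {G : Type*} [Fintype G] {n : ℕ} (p : Fin n × G) : (Fin n → W G) →ₗ[ℝ] ℝ :=
  LinearMap.proj p.2 ∘ₗ (W G).subtype ∘ₗ LinearMap.proj p.1

section Coord

variable {G : Type*} [Fintype G] {n : ℕ}

theorem sum_coord (i : Fin n) (y : Fin n → W G) : ∑ g, coord (i, g) y = 0 := (y i).2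

theorem nontrivial_of_coord_pos {p : Fin n × G} {y : Fin n → W G} (hp : 0 < coord p y) :
    Nontrivial G := by
  by_contra hG
  rw [not_nontrivial_iff_subsingleton] at hG
  exact hp.ne' ((Fintype.sum_subsingleton _ p.2).symm.trans (sum_coord p.1 y))

theorem exists_coord_pos {y : Fin n → W G} (hy : y ≠ 0) : ∃ p, 0 < coord p y := by
  by_contra! hnonpos
  refine hy (funext fun i => Subtype.ext (funext fun g => ?_))
  exact (Finset.sum_eq_zero_iff_of_nonpos fun g _ => hnonpos (i, g)).mp (sum_coord i y) g
    (Finset.mem_univ g)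

theorem abs_coord_sub_le_dist (p : Fin n × G) (y z : Fin n → W G) :
    |coord p y - coord p z| ≤ dist y z :=
  (dist_le_pi_dist (y p.1 : G → ℝ) (z p.1) p.2).trans (dist_le_pi_dist y z p.1)

theorem coord_wPowRep [Group G] (g : G) (p : Fin n × G) (y : Fin n → W G) :
    coord p (wPowRep G n g y) = coord (p.1, g⁻¹ * p.2) y := rfl

end Coord

variable {G : Type*} [Group G] [Fintype G] {n : ℕ}

/-- The vertex of the crosspolytope in the copy of `W_G` with index `p.1` that comes from the basis
vector of `p.2`. -/
noncomputable def label (p : Fin n × G) : Fin n → W G := Pi.single p.1 (wVertex G p.2)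

open Classical in
theorem coord_label (p q : Fin n × G) :
    coord q (label p) =
      if q.1 = p.1 then (if q.2 = p.2 then 1 else 0) - (Fintype.card G : ℝ)⁻¹ else 0 := by
  obtain ⟨i, g⟩ := p
  obtain ⟨j, h⟩ := q
  rcases eq_or_ne j i with rfl | hji
  · simp [coord, label, wVertex, Pi.single_apply]
  · simp [coord, label, hji]

theorem wPowRep_label (g : G) (p : Fin n × G) :
    wPowRep G n g (label p) = label (p.1, g * p.2) := by
  classical
  refine funext fun i => Subtype.ext (funext fun h => ?_)
  change coord (i, h) (wPowRep G n g (label p)) = coord (i, h) (label (p.1, g * p.2))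
  simp only [coord_wPowRep, coord_label, inv_mul_eq_iff_eq_mul]

theorem crosspolytope_eq_convexHull_range_label :
    crosspolytope G n = convexHull ℝ (Set.range (label : Fin n × G → Fin n → W G)) := by
  have hrange : (⋃ i, Set.range fun g : G => (Pi.single i (wVertex G g) : Fin n → W G)) =
      Set.range label := by
    ext y
    simp [label]
  rw [crosspolytope, ← hrange]
  exact (convexHull ℝ).closure_iSup_closure _

theorem label_mem_extremePoints [Nontrivial G] (p : Fin n × G) :
    label p ∈ (crosspolytope G n).extremePoints ℝ := by
  classical
  have hcard : (Fintype.card G : ℝ)⁻¹ < 1 :=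
    inv_lt_one_of_one_lt₀ (Nat.one_lt_cast.mpr Fintype.one_lt_card)
  have hcard₀ : 0 < (Fintype.card G : ℝ)⁻¹ := by positivity
  rw [crosspolytope_eq_convexHull_range_label,
    ← Set.insert_sdiff_self_of_mem (Set.mem_range_self p)]
  refine mem_extremePoints_convexHull_insert (coord p) ?_
  rintro _ ⟨⟨q, rfl⟩, hq⟩
  have hqp : ¬(p.1 = q.1 ∧ p.2 = q.2) := fun h => hq (congrArg label (Prod.ext h.1 h.2).symm)
  simp only [coord_label]
  split_ifs <;> first | linarith | tauto

theorem exists_forall_mem_of_zero_mem_convexHull_label_image {C : Set (Fin n × G)}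
    (hC : 0 ∈ convexHull ℝ (label '' C)) : ∃ i, ∀ g, (i, g) ∈ C := by
  classical
  by_contra! hmissing
  choose γ hγ using hmissing
  -- Every label in `C` has value `-1 / k` under the sum of the coordinates `(i, γ i)`.
  let ℓ : (Fin n → W G) →ₗ[ℝ] ℝ := ∑ i, coord (i, γ i)
  have hneg : label '' C ⊆ {y | ℓ y < 0} := by
    rintro _ ⟨p, hp, rfl⟩
    have hp₂ : γ p.1 ≠ p.2 := fun h => hγ p.1 (h ▸ hp)
    have hcard : 0 < (Fintype.card G : ℝ)⁻¹ := by positivity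
    simpa [ℓ, coord_label, hp₂] using hcard
  have hzero := convexHull_min hneg (convex_halfSpace_lt ℓ.isLinear 0) hC
  simp at hzero

end Crosspolytope

/-! ### From Tucker's lemma to the Borsuk-Ulam theorem -/

section BorsukUlam

theorem exists_pos_forall_exists_le {ι X : Type*} [Finite ι] [TopologicalSpace X] {s : Set X}
    (hs : IsCompact s) {f : ι → X → ℝ} (hf : ∀ i, ContinuousOn (f i) s)
    (hpos : ∀ x ∈ s, ∃ i, 0 < f i x) : ∃ δ > 0, ∀ x ∈ s, ∃ i, δ ≤ f i x := by
  have := Fintype.ofFinite ι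
  rcases isEmpty_or_nonempty ι with hι | hι
  · exact ⟨1, one_pos, fun x hx => isEmptyElim (hpos x hx).choose⟩
  obtain ⟨δ, hδ, hle⟩ := hs.exists_forall_le'
    (ContinuousOn.finset_sup'_apply Finset.univ_nonempty fun i _ => hf i) (a := 0) (by simpa)
  exact ⟨δ, hδ, by simpa using hle⟩

theorem exists_equivariant_to_group {G X : Type*} [Group G] [MulAction G X] {S : Set X}
    (hfree : ∀ x ∈ S, ∀ g : G, g • x = x → g = 1) :
    ∃ γ : X → G, ∀ x ∈ S, ∀ g : G, γ (g • x) = g * γ x := by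
  let orbit (x : X) : MulAction.orbitRel.Quotient G X := ⟦x⟧
  let rep (x : X) : X := (orbit x).out
  have hrep (g : G) (x : X) : rep (g • x) = rep x :=
    congrArg Quotient.out (Quotient.sound ⟨g, rfl⟩)
  choose γ hγ using fun x : X =>
    show ∃ g : G, g • rep x = x from (MulAction.orbitRel G X).symm (Quotient.mk_out x)
  refine ⟨γ, fun x hx g => ?_⟩
  have hfix : (γ x * ((γ (g • x))⁻¹ * g)) • x = x := by
    rw [mul_smul, mul_smul, inv_smul_eq_iff.mpr (hrep g x ▸ hγ (g • x)).symm, hγ]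
  have hinv := eq_inv_of_mul_eq_one_right (hfree x hx _ hfix)
  exact (eq_mul_inv_iff_mul_eq.mp (inv_mul_eq_iff_eq_mul.mp hinv)).symm

theorem exists_equivariant_choice {G X Y : Type*} [Group G] [MulAction G X] [MulAction G Y]
    [Nonempty Y] {S : Set X} (hS : ∀ g : G, ∀ x ∈ S, g • x ∈ S)
    (hfree : ∀ x ∈ S, ∀ g : G, g • x = x → g = 1) {R : X → Y → Prop}
    (hR : ∀ g : G, ∀ x ∈ S, ∀ y, R x y → R (g • x) (g • y)) (hex : ∀ x ∈ S, ∃ y, R x y) :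
    ∃ φ : X → Y, (∀ x ∈ S, R x (φ x)) ∧ ∀ g : G, ∀ x ∈ S, φ (g • x) = g • φ x := by
  obtain ⟨γ, hγ⟩ := exists_equivariant_to_group hfree
  choose! y hy using hex
  refine ⟨fun x => γ x • y ((γ x)⁻¹ • x), fun x hx => ?_, fun g x hx => ?_⟩
  · have hx' := hS (γ x)⁻¹ x hx
    simpa only [smul_inv_smul] using hR (γ x) _ hx' _ (hy _ hx')
  · simp only [hγ x hx g, mul_inv_rev, mul_smul, inv_smul_smul]

variable {G : Type*} [Group G] [Fintype G] {n : ℕ}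

theorem zero_notMem_convexHull_of_forall_eq_label {E : Type*} {f φ : E → Fin n → W G} {δ : ℝ}
    {s : Set E} (hφ : ∀ v ∈ s, ∃ p, φ v = label p ∧ δ ≤ coord p (f v))
    (hf : ∀ u ∈ s, ∀ v ∈ s, dist (f u) (f v) < δ) : 0 ∉ convexHull ℝ (φ '' s) := by
  intro hzero
  have hlabel : φ '' s ⊆ label '' {p | ∃ v ∈ s, δ ≤ coord p (f v)} := by
    rintro _ ⟨v, hv, rfl⟩
    obtain ⟨p, hp, hδ⟩ := hφ v hv
    exact ⟨p, ⟨v, hv, hδ⟩, hp.symm⟩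
  obtain ⟨i, hi⟩ :=
    exists_forall_mem_of_zero_mem_convexHull_label_image (convexHull_mono hlabel hzero)
  obtain ⟨v, hv, -⟩ := hi 1
  have hpos (g : G) : 0 < coord (i, g) (f v) := by
    obtain ⟨u, hu, hδ⟩ := hi g
    linarith [hf u hu v hv, (abs_le.mp (abs_coord_sub_le_dist (i, g) (f u) (f v))).2]
  exact (Finset.sum_pos (fun g _ => hpos g) Finset.univ_nonempty).ne' (sum_coord i (f v))

theorem exists_equivariant_labelling {E : Type*} [AddCommGroup E] [Module ℝ E]
    {ρ : Representation ℝ G E} {X : Set E} (hX : ∀ g, ∀ x ∈ X, ρ g x ∈ X)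
    (hfree : ∀ x ∈ X, ∀ g, ρ g x = x → g = 1) {f : E → Fin n → W G}
    (hf : ∀ g, ∀ x ∈ X, f (ρ g x) = wPowRep G n g (f x)) {δ : ℝ}
    (hδ : ∀ x ∈ X, ∃ p, δ ≤ coord p (f x)) :
    ∃ φ : E → Fin n → W G, (∀ x ∈ X, ∃ p, φ x = label p ∧ δ ≤ coord p (f x)) ∧
      ∀ g, ∀ x ∈ X, φ (ρ g x) = wPowRep G n g (φ x) := by
  let : MulAction G E := MulAction.compHom E ρ
  let : MulAction G (Fin n → W G) := MulAction.compHom _ (wPowRep G n)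
  refine exists_equivariant_choice (R := fun x y => ∃ p, y = label p ∧ δ ≤ coord p (f x)) hX hfree
    ?_ fun x hx => ?_
  · rintro g x hx _ ⟨⟨i, h⟩, rfl, hp⟩
    refine ⟨(i, g * h), wPowRep_label g (i, h), ?_⟩
    change δ ≤ coord _ (f (ρ g x))
    rwa [hf g x hx, coord_wPowRep, inv_mul_cancel_left]
  · obtain ⟨p, hp⟩ := hδ x hx
    exact ⟨label p, p, rfl, hp⟩

theorem IsSubdivision.isCompact_space {E : Type*} [AddCommGroup E] [Module ℝ E]
    [TopologicalSpace E] [IsTopologicalAddGroup E] [ContinuousSMul ℝ E]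
    {K L : SimplicialComplex ℝ E} (h : IsSubdivision K L) : IsCompact L.space := by
  rw [← h.space_eq]
  exact h.finite.isCompact_biUnion fun s _ => s.finite_toSet.isCompact_convexHull ℝ

theorem isBorsukUlamPair_of_forall_isTuckerTriple {E : Type*} [NormedAddCommGroup E]
    [NormedSpace ℝ E] {ρ : Representation ℝ G E} {L : SimplicialComplex ℝ E}
    (hL : IsInvariant ρ L) (hfree : ∀ x ∈ L.space, ∀ g, ρ g x = x → g = 1)
    (hfine : ∀ ε > 0, ∃ K, IsSubdivision K L ∧ IsInvariant ρ K ∧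
      ∀ s ∈ K.faces, ∀ u ∈ s, ∀ v ∈ s, dist u v < ε)
    (hTucker : ∀ K, IsSubdivision K L → IsInvariant ρ K →
      IsTuckerTriple ρ K (wPowRep G n) (crosspolytope G n)) :
    IsBorsukUlamPair ρ L (wPowRep G n) := by
  intro f hfc hfe
  by_contra! hf
  have hcompact : IsCompact L.space := by
    obtain ⟨K, hK, -⟩ := hfine 1 one_pos
    exact hK.isCompact_space
  obtain ⟨δ, hδ, hlarge⟩ := exists_pos_forall_exists_le hcompact
    (fun p => (coord p).continuous_of_finiteDimensional.comp_continuousOn hfc)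
    fun x hx => exists_coord_pos (hf x hx)
  obtain ⟨φ, hφ, hφe⟩ := exists_equivariant_labelling
    (fun g x hx => hL.map_mem_space g hx) hfree hfe hlarge
  obtain ⟨ε, hε, hclose⟩ := Metric.uniformContinuousOn_iff.mp
    (hcompact.uniformContinuousOn_of_continuous hfc) δ hδ
  obtain ⟨K, hK, hKρ, hKε⟩ := hfine ε hε
  have hvertex {v : E} (hv : v ∈ K.vertices) : v ∈ L.space :=
    hK.space_eq ▸ K.vertices_subset_space hv
  have hextreme {v : E} (hv : v ∈ K.vertices) : φ v ∈ (crosspolytope G n).extremePoints ℝ := by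
    obtain ⟨p, hp, hδp⟩ := hφ v (hvertex hv)
    have := nontrivial_of_coord_pos (hδ.trans_le hδp)
    exact hp ▸ label_mem_extremePoints p
  obtain ⟨s, hs, hzero⟩ := hTucker K hK hKρ φ (fun _ => hextreme) fun g v hv => hφe g v (hvertex hv)
  have hsL {v : E} (hv : v ∈ s) : v ∈ L.space := hK.space_eq ▸ K.subset_space hs hv
  exact zero_notMem_convexHull_of_forall_eq_label (fun v hv => hφ v (hsL hv))
    (fun u hu v hv => hclose u (hsL hu) v (hsL hv) (hKε s hs u hu v hv)) hzero

end BorsukUlam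

end TuckerBU

theorem mainTheorem1_general (G : Type*) [Group G] [Fintype G] (n M : ℕ) :
    (∀ K, TuckerBU.IsSubdivision K (TuckerBU.joinComplex G M) →
      TuckerBU.IsInvariant (TuckerBU.joinRep G M) K →
      TuckerBU.IsTuckerTriple (TuckerBU.joinRep G M) K (TuckerBU.wPowRep G n)
        (TuckerBU.crosspolytope G n)) ↔
    TuckerBU.IsBorsukUlamPair (TuckerBU.joinRep G M) (TuckerBU.joinComplex G M)
      (TuckerBU.wPowRep G n) :=
  ⟨TuckerBU.isBorsukUlamPair_of_forall_isTuckerTriple TuckerBU.isInvariant_joinComplex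
      (fun _ hx _ hgx => TuckerBU.eq_one_of_joinRep_eq hx hgx)
      fun _ hε => TuckerBU.exists_fine_invariant_subdivision G M hε,
    fun h _ hK hKρ => h.isTuckerTriple hK hKρ _⟩

theorem mainTheorem1 (G : Type*) [Group G] [Fintype G] :
    TuckerBU.TuckerProperty G ↔ TuckerBU.BorsukUlamProperty G :=
  forall₂_congr fun n _ => mainTheorem1_general G n _
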